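/- Let $f(x,y)$ be a symmetric real function of two positive real variables. It is called escalating if $$f(x_1,x_2)+f(y_1,y_2)\ \ge\ f(x_2,y_1)+f(x_1,y_2)\qquad\text{for all } x_1\ge y_1>0,\ x_2\ge y_2>0,$$ with strict inequality whenever $x_1>y_1$ and $x_2>y_2$. It is called good escalating if moreover $\frac{\partial f}{\partial x}$ and $\frac{\partial^2 f}{\partial x^2}$ exist on the positive quadrant with $\frac{\partial f}{\partial x}>0$ and $\frac{\partial^2 f}{\partial x^2}\ge 0$, and $$f(x_1+1,x_2)+f(x_1+1,y_1-1)\ \ge\ f(x_2,y_1)+f(x_1,y_1)\qquad\text{for all } x_1\ge y_1>1,\ x_2\ge 1.$$ For a finite simple graph $G$ with vertex degrees $d(\cdot)$ put $M_f(G)=\sum_{uv\in E(G)}f(d(u),d(v))$. A connected simple graph with $n$ vertices and $n+c-1$ edges is called $c$-cyclic. For an escalating $f$, an extremal graph of a class of graphs is a member of the class that maximizes $M_f$ over the class. For $n\ge 4$ let $S_n^{(0)}$ be the star on $n$ vertices; let $S_n^{(1)}$ be obtained from $S_n^{(0)}$ by adding one edge between two pendant vertices; and let $S_n^{(2)}$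 be obtained by attaching $n-4$ pendant vertices to one vertex of degree three of $B_1$, where $B_1$ is the graph on four vertices formed by two triangles sharing an edge (that is, $K_4$ minus an edge). Theorem. Let $n\ge 4$, let $f$ be good escalating and let $c\in\{0,1,2\}$. Then $S_n^{(c)}$ is, up to isomorphism, the unique extremal graph among all $c$-cyclic graphs with $n$ vertices: a $c$-cyclic graph on $n$ vertices maximizes $M_f$ among all of them if and only if it is isomorphic to $S_n^{(c)}$. -/

import Mathlib

/-- A bivariate function on the positive reals, symmetric there.  (Values of `f` at non-positive
arguments are irrelevant.) -/
def SymmetricOnPos (f : ℝ → ℝ → ℝ) : Prop :=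
  ∀ x y : ℝ, 0 < x → 0 < y → f x y = f y x

/-- Escalating functions. -/
structure Escalating (f : ℝ → ℝ → ℝ) : Prop where
  symm : SymmetricOnPos f
  le : ∀ x₁ y₁ x₂ y₂ : ℝ, 0 < y₁ → y₁ ≤ x₁ → 0 < y₂ → y₂ ≤ x₂ →
    f x₂ y₁ + f x₁ y₂ ≤ f x₁ x₂ + f y₁ y₂
  lt : ∀ x₁ y₁ x₂ y₂ : ℝ, 0 < y₁ → y₁ < x₁ → 0 < y₂ → y₂ < x₂ →
    f x₂ y₁ + f x₁ y₂ < f x₁ x₂ + f y₁ y₂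

/-- Good escalating functions: the first two partial derivatives in the first variable exist on the
positive quadrant, the first one is positive and the second one is nonnegative, and a further
inequality holds wherever all its terms are defined (that is, for `y₁ - 1 > 0`). -/
structure GoodEscalating (f : ℝ → ℝ → ℝ) : Prop extends Escalating f where
  diff : ∀ x y : ℝ, 0 < x → 0 < y → DifferentiableAt ℝ (fun t => f t y) x
  deriv_pos : ∀ x y : ℝ, 0 < x → 0 < y → 0 < deriv (fun t => f t y) x
  diff_deriv : ∀ x y : ℝ, 0 < x → 0 < y → DifferentiableAt ℝ (deriv (fun t => f t y)) x
  deriv_deriv_nonneg : ∀ x y : ℝ, 0 < x → 0 < y → 0 ≤ deriv (deriv (fun t => f t y)) x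
  shift : ∀ x₁ y₁ x₂ : ℝ, 1 < y₁ → y₁ ≤ x₁ → 1 ≤ x₂ →
    f x₂ y₁ + f x₁ y₁ ≤ f (x₁ + 1) x₂ + f (x₁ + 1) (y₁ - 1)

open Classical in
/-- The connectivity function `M_f(G) = ∑_{uv ∈ E(G)} f(d(u), d(v))`.  The endpoints of an edge are
read off in an arbitrary order; by symmetry of `f` the order does not matter. -/
noncomputable def connectivityFunction {V : Type*} [Fintype V] (f : ℝ → ℝ → ℝ)
    (G : SimpleGraph V) : ℝ :=
  ∑ e ∈ G.edgeFinset, f (G.degree e.out.1) (G.degree e.out.2)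

/-- A `c`-cyclic graph: a connected graph with `n` vertices and `m = n + c - 1` edges. -/
def IsCCyclic {V : Type*} [Fintype V] (c : ℕ) (G : SimpleGraph V) : Prop :=
  G.Connected ∧ G.edgeSet.ncard + 1 = Fintype.card V + c

/-- `G` is an extremal graph of the class `𝒢` with respect to an escalating function `f`: it
belongs to `𝒢` and maximizes the connectivity function in `𝒢`. -/
def IsExtremal {V : Type*} [Fintype V] (f : ℝ → ℝ → ℝ) (𝒢 : Set (SimpleGraph V))
    (G : SimpleGraph V) : Prop :=
  G ∈ 𝒢 ∧ ∀ H ∈ 𝒢, connectivityFunction f H ≤ connectivityFunction f G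

/-- The star with `n` vertices and centre `0`. -/
def star₀ (n : ℕ) : SimpleGraph (Fin n) :=
  SimpleGraph.fromRel fun i _ => i.val = 0

/-- The star with one additional edge, joining the pendant vertices `1` and `2`. -/
def star₁ (n : ℕ) : SimpleGraph (Fin n) :=
  star₀ n ⊔ SimpleGraph.fromRel fun i j => i.val = 1 ∧ j.val = 2

/-- The graph `B₁`: two triangles `0, 1, 2` and `0, 1, 3` sharing the edge `01`, that is, the
complete graph on four vertices without the edge `23`. -/
def graphB₁ : SimpleGraph (Fin 4) :=
  SimpleGraph.fromRel fun i j => ¬ (i = 2 ∧ j = 3) ∧ ¬ (i = 3 ∧ j = 2)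

/-- The graph obtained from `G` by attaching `k` new pendant vertices to the vertex `v`. -/
def attachPendants {V : Type*} (G : SimpleGraph V) (v : V) (k : ℕ) : SimpleGraph (V ⊕ Fin k) where
  Adj
    | .inl a, .inl b => G.Adj a b
    | .inl a, .inr _ => a = v
    | .inr _, .inl b => b = v
    | .inr _, .inr _ => False
  symm := ⟨by
    rintro (a | i) (b | j) h
    · exact G.adj_symm h
    · exact h
    · exact h
    · exact h⟩
  loopless := ⟨by
    rintro (a | i) h
    · exact G.loopless.irrefl a h
    · exact h⟩

/-- The graph obtained from `B₁` by attaching `n - 4` pendant vertices to the vertex `0` of degree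
three; it has `n` vertices when `4 ≤ n`. -/
def star₂ (n : ℕ) : SimpleGraph (Fin 4 ⊕ Fin (n - 4)) :=
  attachPendants graphB₁ 0 (n - 4)

/-! The engine is the Kelmans transformation. Let `u`, `v` be adjacent or have a common neighbour,
with d(v) ≤ d(u), and shift to `u` the m neighbours of `v` that are neither `u` nor adjacent to `u`.
Connectedness, the number of edges and all other degrees survive, while the degrees a, b of `u`, `v`
become a + m, b - m. If m > 0, then M_f strictly increases (`connectivityFunction_lt_kelmans`):
common neighbours do not lose by convexity, neighbours of `u` alone gain by monotonicity, and the
possible loss on the edge `uv` is repaid by the m moved edges (`GoodEscalating.sub_le_mul`).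

Hence in an extremal graph a vertex `u` of maximal degree is adjacent to every other vertex, so the
graph is a cone: all edges at `u` plus c further edges. For c ≤ 1 this fixes the isomorphism type.
For c = 2, another transformation forces the two further edges to meet. A maximizer exists by
finiteness, so the only candidate is extremal. -/

/-! ### Analytic inequalities for good escalating functions. -/

/-- Increments of a convex function on the positive reals are monotone. -/
theorem ConvexOn.add_le_add_of_le {g : ℝ → ℝ} (hg : ConvexOn ℝ (Set.Ioi 0) g) {p q δ : ℝ}
    (hp : 0 < p) (hpq : p ≤ q) (hδ : 0 ≤ δ) : g (p + δ) + g q ≤ g (q + δ) + g p := by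
  rcases hδ.eq_or_lt with rfl | hδ
  · simp [add_comm]
  have hpos : 0 < q + δ - p := by linarith
  have h₁ : (q + δ) ∈ Set.Ioi (0 : ℝ) := by simp only [Set.mem_Ioi]; linarith
  have hs : (q - p) / (q + δ - p) + δ / (q + δ - p) = 1 := by field_simp; ring
  -- Both p + δ and q are convex combinations of p and q + δ, with the two weights exchanged; adding
  -- the two convexity inequalities gives the claim.
  have a₁ := hg.2 hp h₁ (by apply div_nonneg <;> linarith) (by positivity) hs
  have a₂ := hg.2 h₁ hp (by apply div_nonneg <;> linarith) (by positivity) hs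
  simp only [smul_eq_mul] at a₁ a₂
  have e₁ : (q - p) / (q + δ - p) * p + δ / (q + δ - p) * (q + δ) = p + δ := by
    field_simp; ring
  have e₂ : (q - p) / (q + δ - p) * (q + δ) + δ / (q + δ - p) * p = q := by
    field_simp; ring
  rw [e₁] at a₁
  rw [e₂] at a₂
  linear_combination a₁ + a₂ + (g p + g (q + δ)) * hs

namespace GoodEscalating

variable {f : ℝ → ℝ → ℝ}

theorem convexOn (hf : GoodEscalating f) {y : ℝ} (hy : 0 < y) :
    ConvexOn ℝ (Set.Ioi 0) (fun t => f t y) :=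
  convexOn_of_deriv2_nonneg' (convex_Ioi 0)
    (fun x hx => (hf.diff x y hx hy).differentiableWithinAt)
    (fun x hx => (hf.diff_deriv x y hx hy).differentiableWithinAt)
    (fun x hx => hf.deriv_deriv_nonneg x y hx hy)

theorem strictMonoOn (hf : GoodEscalating f) {y : ℝ} (hy : 0 < y) :
    StrictMonoOn (fun t => f t y) (Set.Ioi 0) :=
  strictMonoOn_of_deriv_pos (convex_Ioi 0)
    (fun x hx => (hf.diff x y hx hy).continuousAt.continuousWithinAt)
    (fun x hx => hf.deriv_pos x y (by simpa using hx) hy)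

/-- Telescoping: the `shift` inequality bounds the loss when one unit of degree moves from the
smaller argument to the larger one. -/
theorem sub_le_sum_range (hf : GoodEscalating f) {a b y : ℝ} (hba : b ≤ a) (hy : 1 ≤ y) (k : ℕ)
    (hk : 1 ≤ b - k) :
    f a b - f (a + k) (b - k) ≤ ∑ i ∈ Finset.range k, (f (a + (i + 1)) y - f (b - i) y) := by
  induction k with
  | zero => simp
  | succ k ih =>
    push_cast at hk ⊢
    have h := hf.shift (a + k) (b - k) y (by linarith)
      (by linarith [(Nat.cast_nonneg k : (0 : ℝ) ≤ k)]) hy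
    have hs := hf.symm y (b - k) (by linarith) (by linarith)
    rw [Finset.sum_range_succ]
    have := ih (by linarith)
    have e₁ : a + k + 1 = a + (k + 1 : ℝ) := by ring
    have e₂ : b - k - 1 = b - (k + 1 : ℝ) := by ring
    rw [e₁, e₂] at h
    linarith

/-- The loss on an edge when `k` units of degree are moved from one endpoint to the other is at most
`k` times the gain on any of the edges that are moved. -/
theorem sub_le_mul (hf : GoodEscalating f) {a b y : ℝ} (hba : b ≤ a) (hy : 1 ≤ y) (k : ℕ)
    (hk : 1 ≤ b - k) : f a b - f (a + k) (b - k) ≤ k * (f (a + k) y - f b y) := by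
  refine (hf.sub_le_sum_range hba hy k hk).trans ?_
  -- Reversing only the first sum pairs a + k - i with b - i. Raising both arguments by i increases
  -- their difference of values, by convexity, and turns every term into the same one.
  rw [Finset.sum_sub_distrib, ← Finset.sum_range_reflect, ← Finset.sum_sub_distrib]
  calc _ ≤ ∑ _i ∈ Finset.range k, (f (a + k) y - f b y) := by
        refine Finset.sum_le_sum fun i hi => ?_
        have hi' : i + 1 ≤ k := Finset.mem_range.1 hi
        have hik : (i : ℝ) + 1 ≤ k := by exact_mod_cast hi'
        have hc : ((k - 1 - i : ℕ) : ℝ) = k - 1 - i := by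
          rw [Nat.sub_sub, Nat.cast_sub (by omega)]; push_cast; ring
        have h := (hf.convexOn (by linarith : 0 < y)).add_le_add_of_le
          (p := b - i) (q := a + k - i) (δ := i) (by linarith) (by linarith) (by positivity)
        simp only [sub_add_cancel] at h
        have e : a + (((k - 1 - i : ℕ) : ℝ) + 1) = a + k - i := by rw [hc]; ring
        rw [e]
        linarith
    _ = _ := by rw [Finset.sum_const, Finset.card_range, nsmul_eq_mul]

end GoodEscalating

/-! ### Sums over edges and over ordered pairs. -/

section

variable {V : Type*} [Fintype V]

open Classical in
-- Each edge is counted by its two orientations, which removes the arbitrary choice of `e.out`.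
theorem two_mul_sum_edgeFinset_out (G : SimpleGraph V) (h : V → V → ℝ)
    (hs : ∀ x y, G.Adj x y → h x y = h y x) :
    2 * ∑ e ∈ G.edgeFinset, h e.out.1 e.out.2 = ∑ x, ∑ y, if G.Adj x y then h x y else 0 := by
  rw [← Fintype.sum_prod_type' (f := fun x y => if G.Adj x y then h x y else 0),
    ← Finset.sum_filter,
    ← Finset.sum_fiberwise_of_maps_to (t := G.edgeFinset) (g := fun p : V × V => s(p.1, p.2))
      (by intro p hp; simpa using hp), Finset.mul_sum]
  refine Finset.sum_congr rfl fun e he => ?_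
  obtain ⟨a, b, hab⟩ : ∃ a b, e.out = (a, b) := ⟨_, _, rfl⟩
  have hq : s(a, b) = e := by
    have := Quot.out_eq e
    rw [hab] at this
    exact this
  have hadj : G.Adj a b := by simpa [← hq] using he
  have : (Finset.univ.filter fun p : V × V => G.Adj p.1 p.2).filter
      (fun p => s(p.1, p.2) = e) = {(a, b), (b, a)} := by
    ext ⟨x, y⟩
    simp only [← hq, Finset.mem_filter, Finset.mem_univ, true_and, Sym2.eq_iff,
      Finset.mem_insert, Finset.mem_singleton, Prod.mk.injEq]
    constructor
    · exact fun h => h.2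
    · rintro (⟨rfl, rfl⟩ | ⟨rfl, rfl⟩)
      · exact ⟨hadj, by simp⟩
      · exact ⟨hadj.symm, by simp⟩
  rw [this, Finset.sum_pair (by simp [hadj.ne]), hab, hs b a hadj.symm]
  ring

open Classical in
theorem two_mul_connectivityFunction {f : ℝ → ℝ → ℝ} (hf : SymmetricOnPos f) (G : SimpleGraph V) :
    2 * connectivityFunction f G =
      ∑ x, ∑ y, if G.Adj x y then f (G.degree x) (G.degree y) else 0 := by
  refine two_mul_sum_edgeFinset_out G (fun x y => f (G.degree x) (G.degree y)) fun x y h => ?_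
  refine hf _ _ ?_ ?_ <;> rw [Nat.cast_pos, SimpleGraph.degree_pos_iff_exists_adj]
  exacts [⟨y, h⟩, ⟨x, h.symm⟩]

open Classical in
theorem Fintype.sum_eq_add_add_sum_ne {M : Type*} [AddCommMonoid M] {u v : V} (huv : u ≠ v)
    (h : V → M) : ∑ x, h x = h u + h v + ∑ x with x ≠ u ∧ x ≠ v, h x := by
  have : (Finset.univ.filter fun x : V => ¬ (x ≠ u ∧ x ≠ v)) = {u, v} := by
    ext x; simp; tauto
  rw [← Finset.sum_filter_add_sum_filter_not _ (fun x => x ≠ u ∧ x ≠ v), this,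
    Finset.sum_pair huv, add_comm]

open Classical in
-- Separates the edge `uv`, the edges from `u` or `v` to the rest, and the edges within the rest,
-- which the Kelmans transformation affects differently.
theorem sum_sum_eq_of_symm {u v : V} (huv : u ≠ v) (h : V → V → ℝ) (hs : ∀ x y, h x y = h y x)
    (hu : h u u = 0) (hv : h v v = 0) :
    ∑ x, ∑ y, h x y = 2 * h u v + 2 * ∑ x with x ≠ u ∧ x ≠ v, (h u x + h v x)
      + ∑ x with x ≠ u ∧ x ≠ v, ∑ y with y ≠ u ∧ y ≠ v, h x y := by
  rw [Fintype.sum_eq_add_add_sum_ne huv]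
  simp_rw [Fintype.sum_eq_add_add_sum_ne huv (h _), Finset.sum_add_distrib, hu, hv, hs _ u, hs _ v]
  ring

namespace SimpleGraph

open Classical in
theorem degree_eq_sum (G : SimpleGraph V) (x : V) :
    G.degree x = ∑ y, if G.Adj x y then 1 else 0 := by
  rw [← card_neighborFinset_eq_degree, neighborFinset_eq_filter, Finset.card_filter]

end SimpleGraph

end

/-! ### The Kelmans transformation and its effect on M_f. -/

section

variable {V : Type*}

namespace SimpleGraph

/-- The Kelmans transformation: every neighbour of `v` that is neither `u` nor a neighbour of `u`
is detached from `v` and attached to `u`. -/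
def kelmans (G : SimpleGraph V) (u v : V) : SimpleGraph V :=
  (G \ fromRel fun x y => x = v ∧ y ≠ u ∧ ¬ G.Adj u y) ⊔ fromRel fun x y => x = u ∧ G.Adj v y

variable {G : SimpleGraph V} {u v x y : V}

theorem kelmans_adj_left_right : (G.kelmans u v).Adj u v ↔ G.Adj u v := by
  rcases eq_or_ne u v with rfl | h
  · simp
  · simp [kelmans, h, h.symm, G.adj_comm]

theorem kelmans_adj_left (hxu : x ≠ u) (hxv : x ≠ v) :
    (G.kelmans u v).Adj u x ↔ G.Adj u x ∨ G.Adj v x := by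
  simp only [kelmans, sup_adj, sdiff_adj, fromRel_adj]
  tauto

theorem kelmans_adj_right (huv : u ≠ v) (hxu : x ≠ u) (hxv : x ≠ v) :
    (G.kelmans u v).Adj v x ↔ G.Adj u x ∧ G.Adj v x := by
  simp only [kelmans, sup_adj, sdiff_adj, fromRel_adj]
  tauto

theorem kelmans_adj_of_ne (hxu : x ≠ u) (hxv : x ≠ v) (hyu : y ≠ u) (hyv : y ≠ v) :
    (G.kelmans u v).Adj x y ↔ G.Adj x y := by
  simp only [kelmans, sup_adj, sdiff_adj, fromRel_adj]
  tauto

/-- The edge `uv` or a common neighbour is left in place and still links `u` to `v`; any other edge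
survives or has its end moved from `v` to `u`. -/
theorem Connected.kelmans (hG : G.Connected) (huv : u ≠ v)
    (h : G.Adj u v ∨ ∃ z, G.Adj u z ∧ G.Adj v z) : (G.kelmans u v).Connected := by
  have hreach : (G.kelmans u v).Reachable u v := by
    rcases h with h | ⟨z, hu, hv⟩
    · exact (kelmans_adj_left_right.2 h).reachable
    · exact ((kelmans_adj_left hu.ne' hv.ne').2 (.inl hu)).reachable.trans
        ((kelmans_adj_right huv hu.ne' hv.ne').2 ⟨hu, hv⟩).symm.reachable
  have hu : ∀ x, G.Adj u x → (G.kelmans u v).Reachable u x := fun x hx => by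
    rcases eq_or_ne x v with rfl | hxv
    · exact hreach
    · exact ((kelmans_adj_left hx.ne' hxv).2 (.inl hx)).reachable
  have hv : ∀ x, G.Adj v x → (G.kelmans u v).Reachable v x := fun x hx => by
    rcases eq_or_ne x u with rfl | hxu
    · exact hreach.symm
    · exact hreach.symm.trans ((kelmans_adj_left hxu hx.ne').2 (.inr hx)).reachable
  have hstep : ∀ x y, G.Adj x y → (G.kelmans u v).Reachable x y := fun x y hxy => by
    by_cases hxu : x = u
    · exact hxu ▸ hu y (hxu ▸ hxy)
    by_cases hxv : x = v
    · exact hxv ▸ hv y (hxv ▸ hxy)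
    by_cases hyu : y = u
    · exact hyu ▸ (hu x (hyu ▸ hxy.symm)).symm
    by_cases hyv : y = v
    · exact hyv ▸ (hv x (hyv ▸ hxy.symm)).symm
    exact ((kelmans_adj_of_ne hxu hxv hyu hyv).2 hxy).reachable
  have := hG.nonempty
  refine ⟨fun x y => ?_⟩
  obtain ⟨p⟩ := hG.preconnected x y
  induction p with
  | nil => exact .rfl
  | cons hadj _ ih => exact (hstep _ _ hadj).trans ih

variable [Fintype V]

open Classical in
theorem degree_eq_add_sum_ne (H : SimpleGraph V) (huv : u ≠ v) (x : V) :
    H.degree x = (if H.Adj x u then 1 else 0) + (if H.Adj x v then 1 else 0)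
      + ∑ y with y ≠ u ∧ y ≠ v, if H.Adj x y then 1 else 0 := by
  rw [degree_eq_sum, Fintype.sum_eq_add_add_sum_ne huv]

open Classical in
theorem degree_kelmans_of_ne (huv : u ≠ v) (hxu : x ≠ u) (hxv : x ≠ v) :
    (G.kelmans u v).degree x = G.degree x := by
  rw [degree_eq_add_sum_ne _ huv, degree_eq_add_sum_ne G huv]
  congr 1
  · simp only [adj_comm _ x, kelmans_adj_left hxu hxv, kelmans_adj_right huv hxu hxv]
    by_cases h₁ : G.Adj u x <;> by_cases h₂ : G.Adj v x <;> simp [h₁, h₂]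
  · refine Finset.sum_congr rfl fun y hy => ?_
    simp only [Finset.mem_filter, Finset.mem_univ, true_and] at hy
    simp only [kelmans_adj_of_ne hxu hxv hy.1 hy.2]

open Classical in
theorem degree_kelmans_left (huv : u ≠ v) :
    (G.kelmans u v).degree u = G.degree u + ∑ y with y ≠ u ∧ y ≠ v,
      if G.Adj v y ∧ ¬ G.Adj u y then 1 else 0 := by
  rw [degree_eq_add_sum_ne _ huv, degree_eq_add_sum_ne G huv, add_assoc (_ + _) (Finset.sum _ _),
    ← Finset.sum_add_distrib]
  simp only [kelmans_adj_left_right, SimpleGraph.irrefl]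
  congr 1
  refine Finset.sum_congr rfl fun y hy => ?_
  simp only [Finset.mem_filter, Finset.mem_univ, true_and] at hy
  simp only [kelmans_adj_left hy.1 hy.2]
  by_cases h₁ : G.Adj u y <;> by_cases h₂ : G.Adj v y <;> simp [h₁, h₂]

open Classical in
theorem degree_kelmans_right (huv : u ≠ v) :
    (G.kelmans u v).degree v + (∑ y with y ≠ u ∧ y ≠ v,
      if G.Adj v y ∧ ¬ G.Adj u y then 1 else 0) = G.degree v := by
  rw [degree_eq_add_sum_ne _ huv, degree_eq_add_sum_ne G huv, add_assoc _ (Finset.sum _ _),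
    ← Finset.sum_add_distrib]
  simp only [adj_comm _ v u, kelmans_adj_left_right, SimpleGraph.irrefl]
  congr 1
  refine Finset.sum_congr rfl fun y hy => ?_
  simp only [Finset.mem_filter, Finset.mem_univ, true_and] at hy
  simp only [kelmans_adj_right huv hy.1 hy.2]
  by_cases h₁ : G.Adj u y <;> by_cases h₂ : G.Adj v y <;> simp [h₁, h₂]

theorem ncard_edgeSet_kelmans (huv : u ≠ v) :
    (G.kelmans u v).edgeSet.ncard = G.edgeSet.ncard := by
  classical
  have h := (G.kelmans u v).sum_degrees_eq_twice_card_edges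
  have h' := G.sum_degrees_eq_twice_card_edges
  rw [Fintype.sum_eq_add_add_sum_ne huv] at h h'
  have hl := degree_kelmans_left (G := G) huv
  have hr := degree_kelmans_right (G := G) huv
  have hs : ∑ x with x ≠ u ∧ x ≠ v, (G.kelmans u v).degree x =
      ∑ x with x ≠ u ∧ x ≠ v, G.degree x := Finset.sum_congr rfl fun x hx => by
    simp only [Finset.mem_filter, Finset.mem_univ, true_and] at hx
    exact degree_kelmans_of_ne huv hx.1 hx.2
  rw [← coe_edgeFinset, ← coe_edgeFinset, Set.ncard_coe_finset, Set.ncard_coe_finset]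
  omega

end SimpleGraph

theorem IsCCyclic.kelmans [Fintype V] {G : SimpleGraph V} {u v : V} {c : ℕ} (hG : IsCCyclic c G)
    (huv : u ≠ v) (h : G.Adj u v ∨ ∃ z, G.Adj u z ∧ G.Adj v z) :
    IsCCyclic c (G.kelmans u v) :=
  ⟨hG.1.kelmans huv h, by rw [SimpleGraph.ncard_edgeSet_kelmans huv]; exact hG.2⟩

open SimpleGraph Classical in
theorem connectivityFunction_lt_kelmans [Fintype V] {f : ℝ → ℝ → ℝ} (hf : GoodEscalating f)
    {G : SimpleGraph V} {u v w : V} (huv : u ≠ v)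
    (h : G.Adj u v ∨ ∃ z, G.Adj u z ∧ G.Adj v z) (hd : G.degree v ≤ G.degree u)
    (hw : G.Adj v w) (hwu : w ≠ u) (huw : ¬ G.Adj u w) :
    connectivityFunction f G < connectivityFunction f (G.kelmans u v) := by
  set K := G.kelmans u v with hK
  set S : Finset V := Finset.univ.filter fun x => x ≠ u ∧ x ≠ v with hS
  have memS : ∀ {x}, x ∈ S ↔ x ≠ u ∧ x ≠ v := by simp [hS]
  set m : ℕ := ∑ y ∈ S, if G.Adj v y ∧ ¬ G.Adj u y then 1 else 0 with hm
  have hl : K.degree u = G.degree u + m := degree_kelmans_left huv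
  have hr : K.degree v + m = G.degree v := degree_kelmans_right huv
  have hne : ∀ {x}, x ≠ u → x ≠ v → K.degree x = G.degree x := degree_kelmans_of_ne huv
  have hwS : w ∈ S := memS.2 ⟨hwu, hw.ne'⟩
  have hm0 : 0 < m := by
    refine lt_of_lt_of_le ?_ (Finset.single_le_sum (fun _ _ => Nat.zero_le _) hwS)
    simp [hw, huw]
  have hm0' : (0 : ℝ) < m := by exact_mod_cast hm0
  have hKv : 1 ≤ K.degree v := by
    refine (K.degree_pos_iff_exists_adj v).2 ?_
    rcases h with h | ⟨z, hu, hv⟩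
    · exact ⟨u, (kelmans_adj_left_right.2 h).symm⟩
    · exact ⟨z, (kelmans_adj_right huv hu.ne' hv.ne').2 ⟨hu, hv⟩⟩
  -- Since `v` has the private neighbour `w` and d(v) ≤ d(u), counting gives `u` a private neighbour
  -- `t`. The strict inequality will come from the edge `ut`.
  obtain ⟨t, htS, hut, hvt⟩ : ∃ t ∈ S, G.Adj u t ∧ ¬ G.Adj v t := by
    by_contra! hcon
    have h₁ := degree_eq_add_sum_ne G huv u
    have h₂ := degree_eq_add_sum_ne G huv v
    simp only [SimpleGraph.irrefl, G.adj_comm v u, if_false, ← hS] at h₁ h₂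
    have : (∑ y ∈ S, if G.Adj u y then 1 else 0) < ∑ y ∈ S, if G.Adj v y then 1 else 0 := by
      refine Finset.sum_lt_sum (fun y hy => ?_) ⟨w, hwS, by simp [hw, huw]⟩
      by_cases hy' : G.Adj u y
      · simp [hy', hcon y hy hy']
      · simp [hy']
    omega
  set a : ℝ := ((G.degree u : ℕ) : ℝ) with ha
  set b : ℝ := ((G.degree v : ℕ) : ℝ) with hb
  have hba : b ≤ a := Nat.cast_le.2 hd
  have hKu' : (K.degree u : ℝ) = a + m := by rw [hl]; push_cast; rfl
  have hKv' : (K.degree v : ℝ) = b - m := by rw [hb, ← hr]; push_cast; ring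
  have hbm : 1 ≤ b - m := by rw [← hKv']; exact_mod_cast hKv
  -- The loss on the edge `uv`, zero if there is none; it is charged in equal shares D / m to the m
  -- moved edges.
  set D : ℝ := if G.Adj u v then f a b - f (a + m) (b - m) else 0 with hD
  have hDle : ∀ y : ℝ, 1 ≤ y → D / m ≤ f (a + m) y - f b y := fun y hy => by
    rw [div_le_iff₀' hm0']
    by_cases hadj : G.Adj u v
    · simp only [hD, hadj, if_true]
      exact hf.sub_le_mul hba hy m hbm
    · simp only [hD, hadj, if_false]
      have := (hf.strictMonoOn (by linarith : 0 < y)).monotoneOn (a := b) (b := a + m)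
        (Set.mem_Ioi.2 (by linarith)) (Set.mem_Ioi.2 (by linarith)) (by linarith)
      exact mul_nonneg hm0'.le (by simpa using this)
  have one_le : ∀ {x y : V}, G.Adj x y → (1 : ℝ) ≤ G.degree y := fun {x y} hxy => by
    exact_mod_cast (G.degree_pos_iff_exists_adj y).2 ⟨x, hxy.symm⟩
  have key : (∑ x ∈ S, (((if G.Adj u x then f a (G.degree x) else 0) +
      (if G.Adj v x then f b (G.degree x) else 0)) +
        D / m * (if G.Adj v x ∧ ¬ G.Adj u x then 1 else 0))) <
      ∑ x ∈ S, ((if K.Adj u x then f (K.degree u) (K.degree x) else 0) +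
        (if K.Adj v x then f (K.degree v) (K.degree x) else 0)) := by
    have hlt : ∀ x, G.Adj u x → f a (G.degree x) < f (a + m) (G.degree x) := fun x hx =>
      hf.strictMonoOn (by linarith [one_le hx] : (0 : ℝ) < G.degree x)
        (Set.mem_Ioi.2 (by linarith)) (Set.mem_Ioi.2 (by linarith)) (by linarith)
    refine Finset.sum_lt_sum (fun x hx => ?_) ⟨t, htS, ?_⟩
    · obtain ⟨hxu, hxv⟩ := memS.1 hx
      rw [hne hxu hxv, hKu', hKv']
      simp only [hK, kelmans_adj_left hxu hxv, kelmans_adj_right huv hxu hxv]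
      -- Common neighbours use convexity, neighbours of `u` alone monotonicity, and neighbours of
      -- `v` alone the share D / m.
      by_cases h₁ : G.Adj u x <;> by_cases h₂ : G.Adj v x <;>
        simp only [h₁, h₂, or_true, or_false, and_self, and_true, and_false, if_true,
          if_false, not_true, not_false_iff, mul_one, mul_zero, add_zero, zero_add, le_refl]
      · have := (hf.convexOn (by linarith [one_le h₁] : (0 : ℝ) < G.degree x)).add_le_add_of_le
          (p := b - m) (q := a) (δ := m) (by linarith) (by linarith) hm0'.le
        simp only [sub_add_cancel] at this
        linarith
      · exact (hlt x h₁).le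
      · linarith [hDle _ (one_le h₂)]
    · obtain ⟨hxu, hxv⟩ := memS.1 htS
      rw [hne hxu hxv, hKu', hKv']
      simp only [hK, kelmans_adj_left hxu hxv, kelmans_adj_right huv hxu hxv]
      simpa [hut, hvt] using hlt t hut
  have hsum : ∑ x ∈ S, D / m * (if G.Adj v x ∧ ¬ G.Adj u x then (1 : ℝ) else 0) = D := by
    rw [← Finset.mul_sum]
    have : (∑ x ∈ S, if G.Adj v x ∧ ¬ G.Adj u x then (1 : ℝ) else 0) = m := by
      rw [hm]; push_cast; rfl
    rw [this]
    field_simp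
  rw [Finset.sum_add_distrib, hsum] at key
  have hrest : (∑ x ∈ S, ∑ y ∈ S, if K.Adj x y then f (K.degree x) (K.degree y) else 0) =
      ∑ x ∈ S, ∑ y ∈ S, if G.Adj x y then f (G.degree x) (G.degree y) else 0 :=
    Finset.sum_congr rfl fun x hx => Finset.sum_congr rfl fun y hy => by
      obtain ⟨hxu, hxv⟩ := memS.1 hx
      obtain ⟨hyu, hyv⟩ := memS.1 hy
      rw [hne hxu hxv, hne hyu hyv]
      simp only [hK, kelmans_adj_of_ne hxu hxv hyu hyv]
  have hsymm : ∀ (H : SimpleGraph V) (x y : V),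
      (if H.Adj x y then f (H.degree x) (H.degree y) else 0) =
        if H.Adj y x then f (H.degree y) (H.degree x) else 0 := fun H x y => by
    by_cases hxy : H.Adj x y
    · simp only [hxy, hxy.symm, if_true]
      refine hf.symm _ _ ?_ ?_ <;> rw [Nat.cast_pos, degree_pos_iff_exists_adj]
      exacts [⟨y, hxy⟩, ⟨x, hxy.symm⟩]
    · simp [hxy, H.adj_comm y x]
  have hGsum := two_mul_connectivityFunction hf.symm G
  have hKsum := two_mul_connectivityFunction hf.symm K
  rw [sum_sum_eq_of_symm huv _ (hsymm _) (by simp) (by simp)] at hGsum hKsum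
  rw [← hS, hrest] at hKsum
  rw [← hS] at hGsum
  have hKuv : (if K.Adj u v then f (K.degree u) (K.degree v) else 0) =
      (if G.Adj u v then f a b else 0) - D := by
    rw [hKu', hKv', hK]
    by_cases hadj : G.Adj u v <;> simp [kelmans_adj_left_right, hadj, hD]
  rw [hKuv] at hKsum
  linarith

end

/-! ### Cones and invariance under isomorphism. -/

section

variable {V W : Type*}

namespace SimpleGraph

/-- The graph whose edges are all the edges at `u` together with those in `S`. -/
def cone (u : V) (S : Set (Sym2 V)) : SimpleGraph V := fromEdgeSet ({e | u ∈ e} ∪ S)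

theorem cone_adj {u : V} {S : Set (Sym2 V)} {x y : V} :
    (cone u S).Adj x y ↔ (u = x ∨ u = y ∨ s(x, y) ∈ S) ∧ x ≠ y := by
  simp only [cone, fromEdgeSet_adj, Set.mem_union, Set.mem_ofPred_eq, Sym2.mem_iff, or_assoc]

theorem eq_cone {G : SimpleGraph V} {u : V} (h : ∀ x, x ≠ u → G.Adj u x) :
    G = cone u {e ∈ G.edgeSet | u ∉ e} := by
  ext x y
  simp only [cone_adj, Set.mem_ofPred_eq, mem_edgeSet, Sym2.mem_iff]
  constructor
  · intro hxy
    have := hxy.ne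
    tauto
  · rintro ⟨rfl | rfl | hxy, hne⟩
    · exact h y hne.symm
    · exact (h x hne).symm
    · exact hxy.1

theorem connected_cone (u : V) (S : Set (Sym2 V)) : (cone u S).Connected := by
  have : ∀ x, (cone u S).Reachable u x := fun x => by
    rcases eq_or_ne u x with rfl | h
    · exact .rfl
    · exact (cone_adj.2 ⟨.inl rfl, h⟩ : (cone u S).Adj u x).reachable
  have : Nonempty V := ⟨u⟩
  exact ⟨fun x y => (‹∀ x, (cone u S).Reachable u x› x).symm.trans (‹∀ x, _› y)⟩

theorem ncard_edgeSet_cone [Fintype V] {u : V} {S : Set (Sym2 V)}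
    (hS : ∀ e ∈ S, u ∉ e ∧ ¬ e.IsDiag) :
    (cone u S).edgeSet.ncard + 1 = Fintype.card V + S.ncard := by
  have he : (cone u S).edgeSet = (fun x => s(u, x)) '' {u}ᶜ ∪ S := by
    ext e
    induction e with | _ x y
    simp only [mem_edgeSet, cone_adj, Set.mem_union, Set.mem_image, Set.mem_compl_iff,
      Set.mem_singleton_iff, Sym2.eq_iff]
    constructor
    · rintro ⟨rfl | rfl | h, hne⟩
      · exact .inl ⟨y, hne.symm, by simp⟩
      · exact .inl ⟨x, hne, by simp⟩
      · exact .inr h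
    · rintro (⟨z, hz, ⟨rfl, rfl⟩ | ⟨rfl, rfl⟩⟩ | h)
      · exact ⟨.inl rfl, Ne.symm hz⟩
      · exact ⟨.inr (.inl rfl), hz⟩
      · exact ⟨.inr (.inr h), (hS _ h).2⟩
  rw [he, Set.ncard_union_eq _ (Set.toFinite _) (Set.toFinite _), Set.ncard_image_of_injective]
  · have := Set.ncard_add_ncard_compl ({u} : Set V)
    rw [Set.ncard_singleton, Nat.card_eq_fintype_card] at this
    omega
  · intro x y h
    exact Sym2.congr_right.1 h
  · rw [Set.disjoint_left]
    rintro _ ⟨x, -, rfl⟩ h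
    exact (hS _ h).1 (by simp)

theorem isCCyclic_cone_iff [Fintype V] {u : V} {S : Set (Sym2 V)} {c : ℕ}
    (hS : ∀ e ∈ S, u ∉ e ∧ ¬ e.IsDiag) : IsCCyclic c (cone u S) ↔ S.ncard = c := by
  have := ncard_edgeSet_cone hS
  simp only [IsCCyclic, connected_cone, true_and]
  omega

/-- An equivalence of vertex types that respects the data of two cones induces an isomorphism. -/
def coneIso {u : V} {S : Set (Sym2 V)} {u' : W} {S' : Set (Sym2 W)} (e : V ≃ W) (hu : e u = u')
    (hS : ∀ x y, s(e x, e y) ∈ S' ↔ s(x, y) ∈ S) : cone u S ≃g cone u' S' where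
  toEquiv := e
  map_rel_iff' {x y} := by
    simp only [cone_adj, ← hu, hS, ne_eq, EmbeddingLike.apply_eq_iff_eq]

end SimpleGraph

theorem Fintype.exists_equiv_extending_pair [Fintype V] [Fintype W]
    (h : Fintype.card V = Fintype.card W) {k : ℕ} {a : Fin k → V} {b : Fin k → W}
    (ha : Function.Injective a) (hb : Function.Injective b) : ∃ e : V ≃ W, ∀ i, e (a i) = b i := by
  let e₀ := Fintype.equivOfCardEq h
  obtain ⟨σ, hσ⟩ := Equiv.Perm.exists_extending_pair (e₀ ∘ a) b (e₀.injective.comp ha) hb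
  exact ⟨e₀.trans σ, fun i => by simpa using hσ i⟩

open SimpleGraph

theorem IsCCyclic.of_iso [Fintype V] [Fintype W] {G : SimpleGraph V} {H : SimpleGraph W} {c : ℕ}
    (e : G ≃g H) (hG : IsCCyclic c G) : IsCCyclic c H := by
  refine ⟨e.connected_iff.1 hG.1, ?_⟩
  rw [← Fintype.card_congr e.toEquiv, ← hG.2, ← Nat.card_coe_set_eq, ← Nat.card_coe_set_eq,
    Nat.card_congr e.mapEdgeSet]

theorem connectivityFunction_congr [Fintype V] [Fintype W] {f : ℝ → ℝ → ℝ} (hf : SymmetricOnPos f)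
    {G : SimpleGraph V} {H : SimpleGraph W} (e : G ≃g H) :
    connectivityFunction f G = connectivityFunction f H := by
  classical
  have hG := two_mul_connectivityFunction hf G
  have hH := two_mul_connectivityFunction hf H
  rw [← e.toEquiv.sum_comp] at hH
  have : ∀ x, H.degree (e.toEquiv x) = G.degree x := fun x => e.degree_eq x
  simp_rw [← e.toEquiv.sum_comp (fun y => if H.Adj _ y then _ else _), this] at hH
  have hadj : ∀ x y, H.Adj (e.toEquiv x) (e.toEquiv y) ↔ G.Adj x y := fun x y => e.map_rel_iff
  simp only [hadj] at hH
  refine mul_left_cancel₀ two_ne_zero (hG.trans (Eq.trans ?_ hH.symm))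
  congr!

/-- If every extremal graph is isomorphic to one model in the class, then the extremal graphs are
exactly the graphs isomorphic to the model. -/
theorem isExtremal_iff_of_forall_iso [Fintype V] [Fintype W] {f : ℝ → ℝ → ℝ}
    (hf : SymmetricOnPos f) {c : ℕ} {H : SimpleGraph W} (hH : IsCCyclic c H)
    (h : ∀ G : SimpleGraph V, IsExtremal f {H | IsCCyclic c H} G → Nonempty (G ≃g H))
    (G : SimpleGraph V) : IsExtremal f {H | IsCCyclic c H} G ↔ Nonempty (G ≃g H) := by
  refine ⟨h G, fun ⟨e⟩ => ?_⟩
  have hG : IsCCyclic c G := hH.of_iso e.symm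
  -- A maximizer exists because the vertex set carries finitely many graphs; by hypothesis it is
  -- isomorphic to the model, so `G` attains the same value.
  obtain ⟨K, hK, hmax⟩ := Set.exists_max_image {H : SimpleGraph V | IsCCyclic c H}
    (connectivityFunction f) (Set.toFinite _) ⟨G, hG⟩
  obtain ⟨e'⟩ := h K ⟨hK, hmax⟩
  refine ⟨hG, fun L hL => (hmax L hL).trans_eq ?_⟩
  rw [connectivityFunction_congr hf e, connectivityFunction_congr hf e']

/-! ### Structure of extremal graphs. -/

open Classical in
theorem IsExtremal.adj_of_degree_le [Fintype V] {f : ℝ → ℝ → ℝ} (hf : GoodEscalating f) {c : ℕ}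
    {G : SimpleGraph V} (hG : IsExtremal f {H | IsCCyclic c H} G) {u v w : V} (huv : u ≠ v)
    (h : G.Adj u v ∨ ∃ z, G.Adj u z ∧ G.Adj v z) (hd : G.degree v ≤ G.degree u)
    (hw : G.Adj v w) (hwu : w ≠ u) : G.Adj u w := by
  by_contra huw
  exact (connectivityFunction_lt_kelmans hf huv h hd hw hwu huw).not_ge
    (hG.2 _ (IsCCyclic.kelmans hG.1 huv h))

theorem IsExtremal.exists_forall_adj [Fintype V] {f : ℝ → ℝ → ℝ} (hf : GoodEscalating f) {c : ℕ}
    {G : SimpleGraph V} (hG : IsExtremal f {H | IsCCyclic c H} G) :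
    ∃ u, ∀ x, x ≠ u → G.Adj u x := by
  classical
  have hconn : G.Connected := hG.1.1
  have := hconn.nonempty
  obtain ⟨u, hu⟩ := Finite.exists_max fun x => G.degree x
  -- With `u` of maximal degree, the transformation applies to `u` and each neighbour of `u`, so the
  -- closed neighbourhood of `u` cannot be left along an edge.
  have key : ∀ {x y : V}, G.Walk x y → x = u ∨ G.Adj u x → y = u ∨ G.Adj u y := by
    intro x y p
    induction p with
    | nil => exact id
    | @cons x y z hxy _ ih =>
      refine fun hx => ih ?_
      rcases hx with rfl | hx
      · exact .inr hxy
      · exact or_iff_not_imp_left.2 fun hyu =>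
          hG.adj_of_degree_le hf hx.ne (.inl hx) (by convert hu x) hxy hyu
  refine ⟨u, fun x hx => ?_⟩
  obtain ⟨p⟩ := hconn.preconnected u x
  exact (key p (.inl rfl)).resolve_left hx

theorem IsExtremal.exists_eq_cone [Fintype V] {f : ℝ → ℝ → ℝ} (hf : GoodEscalating f) {c : ℕ}
    {G : SimpleGraph V} (hG : IsExtremal f {H | IsCCyclic c H} G) :
    ∃ u S, G = cone u S ∧ S.ncard = c ∧ ∀ e ∈ S, u ∉ e ∧ ¬ e.IsDiag := by
  obtain ⟨u, hu⟩ := hG.exists_forall_adj hf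
  have hS : ∀ e ∈ {e ∈ G.edgeSet | u ∉ e}, u ∉ e ∧ ¬ e.IsDiag :=
    fun e he => ⟨he.2, G.not_isDiag_of_mem_edgeSet he.1⟩
  refine ⟨u, _, eq_cone hu, ?_, hS⟩
  rw [← isCCyclic_cone_iff hS, ← eq_cone hu]
  exact hG.1

/-- In an extremal cone, two edges avoiding the apex have a common endpoint. -/
theorem IsExtremal.not_disjoint_of_cone [Fintype V] {f : ℝ → ℝ → ℝ} (hf : GoodEscalating f)
    {c : ℕ} {u p q r t : V} (hG : IsExtremal f {H | IsCCyclic c H} (cone u {s(p, q), s(r, t)}))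
    (hS : ∀ e ∈ ({s(p, q), s(r, t)} : Set (Sym2 V)), u ∉ e ∧ ¬ e.IsDiag) :
    p = r ∨ p = t ∨ q = r ∨ q = t := by
  classical
  by_contra! hcon
  obtain ⟨hpr, hpt, hqr, hqt⟩ := hcon
  have hpq := hS s(p, q) (by simp)
  have hrt := hS s(r, t) (by simp)
  simp only [Sym2.mem_iff, not_or, Sym2.mk_isDiag_iff] at hpq hrt
  obtain ⟨⟨hup, huq⟩, hpq⟩ := hpq
  obtain ⟨⟨hur, hut⟩, hrt⟩ := hrt
  have key : ∀ {x y}, (cone u {s(p, q), s(r, t)}).Adj x y ↔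
      (u = x ∨ u = y ∨ s(x, y) ∈ ({s(p, q), s(r, t)} : Set (Sym2 V))) ∧ x ≠ y := cone_adj
  have hz : ∃ z, (cone u {s(p, q), s(r, t)}).Adj p z ∧ (cone u {s(p, q), s(r, t)}).Adj r z :=
    ⟨u, key.2 ⟨.inr (.inl rfl), Ne.symm hup⟩, key.2 ⟨.inr (.inl rfl), Ne.symm hur⟩⟩
  -- The apex is a common neighbour of p and r. Were the edges disjoint, whichever of p, r has the
  -- smaller degree would have a private neighbour (t or q), contradicting extremality.
  rcases le_total ((cone u {s(p, q), s(r, t)}).degree r) ((cone u {s(p, q), s(r, t)}).degree p)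
    with hd | hd
  · have := hG.adj_of_degree_le hf hpr (.inr hz) hd
      (key.2 ⟨by simp, hrt⟩ : (cone u {s(p, q), s(r, t)}).Adj r t) hpt.symm
    rw [key] at this
    simp [hup, hut, hpr, hpt, hpt.symm, hqt.symm] at this
  · have := hG.adj_of_degree_le hf hpr.symm (.inr (hz.imp fun _ => And.symm)) hd
      (key.2 ⟨by simp, hpq⟩ : (cone u {s(p, q), s(r, t)}).Adj p q) hqr
    rw [key] at this
    simp [hur, huq, hpr.symm, hqr.symm, hqr, hqt] at this

theorem IsExtremal.exists_eq_cone_pair [Fintype V] {f : ℝ → ℝ → ℝ} (hf : GoodEscalating f)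
    {G : SimpleGraph V} (hG : IsExtremal f {H | IsCCyclic 2 H} G) :
    ∃ u p q r, G = cone u {s(p, q), s(p, r)} ∧ Function.Injective ![u, p, q, r] := by
  obtain ⟨u, S, rfl, hc, hS⟩ := hG.exists_eq_cone hf
  obtain ⟨e, e', hne, rfl⟩ := Set.ncard_eq_two.1 hc
  obtain ⟨p, q, r, rfl, rfl⟩ : ∃ p q r, e = s(p, q) ∧ e' = s(p, r) := by
    induction e with | _ p q
    induction e' with | _ r t
    rcases hG.not_disjoint_of_cone hf hS with rfl | rfl | rfl | rfl
    · exact ⟨p, q, t, rfl, rfl⟩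
    · exact ⟨p, q, r, rfl, Sym2.eq_swap⟩
    · exact ⟨q, p, t, Sym2.eq_swap, rfl⟩
    · exact ⟨q, p, r, Sym2.eq_swap, Sym2.eq_swap⟩
  refine ⟨u, p, q, r, rfl, ?_⟩
  have hpq := hS s(p, q) (by simp)
  have hpr := hS s(p, r) (by simp)
  simp only [Sym2.mem_iff, not_or, Sym2.mk_isDiag_iff] at hpq hpr
  have hqr : q ≠ r := by rintro rfl; exact hne rfl
  intro i j
  fin_cases i <;> fin_cases j <;> simp <;> grind

/-! ### The three model graphs as cones, and the main theorem. -/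

theorem star₀_eq_cone (k : ℕ) : star₀ (k + 4) = cone 0 ∅ := by
  ext x y
  simp only [star₀, fromRel_adj, cone_adj, Fin.ext_iff, Fin.val_zero, Set.mem_empty_iff_false]
  grind

theorem star₁_eq_cone (k : ℕ) : star₁ (k + 4) = cone 0 {s(1, 2)} := by
  ext x y
  have h₁ : ((1 : Fin (k + 4)) : ℕ) = 1 := rfl
  have h₂ : ((2 : Fin (k + 4)) : ℕ) = 2 := rfl
  simp only [star₁, star₀, sup_adj, fromRel_adj, cone_adj, Set.mem_singleton_iff, Sym2.eq_iff,
    Fin.ext_iff, Fin.val_zero, ne_eq, h₁, h₂]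
  grind

theorem star₂_eq_cone (n : ℕ) :
    star₂ n = cone (.inl 0) {s(.inl 1, .inl 2), s(.inl 1, .inl 3)} := by
  ext x y
  rcases x with x | x <;> rcases y with y | y
  · simp only [star₂, attachPendants, graphB₁, fromRel_adj, cone_adj, Set.mem_insert_iff,
      Set.mem_singleton_iff, Sym2.eq_iff, Sum.inl.injEq, ne_eq]
    revert x y
    decide
  all_goals simp [star₂, attachPendants, cone_adj, eq_comm]

end

theorem mainTheorem8 {V : Type*} [Fintype V] (n : ℕ) (hn : 4 ≤ n) (hV : Fintype.card V = n)
    (f : ℝ → ℝ → ℝ) (hf : GoodEscalating f) :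
    (∀ G : SimpleGraph V,
      IsExtremal f {H | IsCCyclic 0 H} G ↔ Nonempty (G ≃g star₀ n)) ∧
    (∀ G : SimpleGraph V,
      IsExtremal f {H | IsCCyclic 1 H} G ↔ Nonempty (G ≃g star₁ n)) ∧
    (∀ G : SimpleGraph V,
      IsExtremal f {H | IsCCyclic 2 H} G ↔ Nonempty (G ≃g star₂ n)) := by
  obtain ⟨k, rfl⟩ := Nat.exists_eq_add_of_le' hn
  have hcard : Fintype.card V = Fintype.card (Fin (k + 4)) := by simpa using hV
  have hcard₂ : Fintype.card V = Fintype.card (Fin 4 ⊕ Fin (k + 4 - 4)) := by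
    simp [hV, add_comm]
  rw [star₀_eq_cone, star₁_eq_cone, star₂_eq_cone]
  have h₀₁ : (0 : Fin (k + 4)) ≠ 1 := by simp
  have h₀₂ : (0 : Fin (k + 4)) ≠ 2 := by rw [ne_eq, Fin.ext_iff]; exact Nat.zero_ne_add_one 1
  have h₁₂ : (1 : Fin (k + 4)) ≠ 2 := by rw [ne_eq, Fin.ext_iff]; exact Nat.ne_of_beq_eq_false rfl
  refine ⟨isExtremal_iff_of_forall_iso hf.symm ((SimpleGraph.isCCyclic_cone_iff (by simp)).2 (by simp))
    fun G hG => ?_, isExtremal_iff_of_forall_iso hf.symm ((SimpleGraph.isCCyclic_cone_iff ?_).2 (by simp))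
    fun G hG => ?_, isExtremal_iff_of_forall_iso hf.symm ((SimpleGraph.isCCyclic_cone_iff (by simp)).2
    (Set.ncard_pair (by simp))) fun G hG => ?_⟩
  · obtain ⟨u, S, rfl, hc, hS⟩ := hG.exists_eq_cone hf
    obtain rfl := (Set.ncard_eq_zero).1 hc
    -- Only the apex and the ends of the extra edges (here none) need prescribed images; any
    -- bijection extending these is an isomorphism of cones.
    obtain ⟨e, he⟩ := Fintype.exists_equiv_extending_pair hcard (a := ![u]) (b := ![0])
      (Function.injective_of_subsingleton _) (Function.injective_of_subsingleton _)
    exact ⟨SimpleGraph.coneIso e (he 0) (by simp)⟩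
  · simpa [h₁₂] using And.intro h₀₁ h₀₂
  · obtain ⟨u, S, rfl, hc, hS⟩ := hG.exists_eq_cone hf
    obtain ⟨e, rfl⟩ := Set.ncard_eq_one.1 hc
    induction e with | _ p q
    have hpq := hS s(p, q) (by simp)
    simp only [Sym2.mem_iff, not_or, Sym2.mk_isDiag_iff] at hpq
    obtain ⟨e, he⟩ := Fintype.exists_equiv_extending_pair hcard (a := ![u, p, q]) (b := ![0, 1, 2])
      (by intro i j; fin_cases i <;> fin_cases j <;> simp <;> grind)
      (by intro i j; fin_cases i <;> fin_cases j <;> simp <;> grind)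
    have h0 : e u = 0 := he 0
    have h1 : e p = 1 := he 1
    have h2 : e q = 2 := he 2
    exact ⟨SimpleGraph.coneIso e h0 fun x y => by simp [← h1, ← h2]⟩
  · obtain ⟨u, p, q, r, rfl, hinj⟩ := hG.exists_eq_cone_pair hf
    obtain ⟨e, he⟩ := Fintype.exists_equiv_extending_pair hcard₂ (a := ![u, p, q, r])
      (b := Sum.inl) hinj Sum.inl_injective
    have h0 : e u = .inl 0 := he 0
    have h1 : e p = .inl 1 := he 1
    have h2 : e q = .inl 2 := he 2
    have h3 : e r = .inl 3 := he 3
    exact ⟨SimpleGraph.coneIso e h0 fun x y => by simp [← h1, ← h2, ← h3]⟩
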